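/- Let $D=\sum_{n>0,\ (n,6)=1}x^{n^{2}}\in \mathbb{Z}/2[[x]]$, and let $T_5:\mathbb{Z}/2[[x]]\to \mathbb{Z}/2[[x]]$ be the formal Hecke operator $\sum_{n\ge 0} c_n x^n\mapsto \sum_{n\ge 0} c_{5n}x^n+\sum_{n\ge 0} c_n x^{5n}$. Let $W1$ and $W5$ be the $\mathbb{Z}/2$-subspaces of $\mathbb{Z}/2[[x]]$ spanned by the $D^k$ with $k>0$ and $k\equiv 1 \bmod 6$, respectively $k\equiv 5\bmod 6$. **Theorem 4.20.** For every integer $m\ge 0$, $T_5(D^{6m+5})$ is equal to $D^{6m+1}$ plus a (possibly empty) sum of powers $D^{6r+1}$ with $0\le r<m$. In particular, $T_5$ maps $W5$ into $W1$, and the map $T_5:W5\to W1$ is one-to-one and onto. -/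

import Mathlib

open PowerSeries

noncomputable section

/-- The formal Hecke operator `T_p` on `Z/2[[x]]`, for `p` an odd prime: it takes
`∑ c_n x^n` to `∑ c_{pn} x^n + ∑ c_n x^{pn}`. -/
def heckeT (p : ℕ) : (ZMod 2)⟦X⟧ →ₗ[ZMod 2] (ZMod 2)⟦X⟧ where
  toFun f := PowerSeries.mk fun n =>
    coeff (p * n) f + if p ∣ n then coeff (n / p) f else 0
  map_add' f g := by
    ext n
    simp only [coeff_mk, map_add]
    split_ifs <;> ring
  map_smul' a f := by
    ext n
    simp [mul_add]

open Classical in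
/-- `D = ∑ x^(n^2)` in `Z/2[[x]]`, the sum over the `n > 0` prime to `6`. -/
def seriesD : (ZMod 2)⟦X⟧ :=
  PowerSeries.mk fun N => if ∃ n : ℕ, 0 < n ∧ n.Coprime 6 ∧ N = n ^ 2 then 1 else 0

/-- The space `W1`: the span of the `D^k`, `k ≡ 1 mod 6`, `k > 0`. -/
def spaceW1 : Submodule (ZMod 2) (ZMod 2)⟦X⟧ :=
  Submodule.span (ZMod 2) {f | ∃ k : ℕ, 0 < k ∧ k ≡ 1 [MOD 6] ∧ f = seriesD ^ k}

/-- The space `W5`: the span of the `D^k`, `k ≡ 5 mod 6`, `k > 0`. -/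
def spaceW5 : Submodule (ZMod 2) (ZMod 2)⟦X⟧ :=
  Submodule.span (ZMod 2) {f | ∃ k : ℕ, 0 < k ∧ k ≡ 5 [MOD 6] ∧ f = seriesD ^ k}

end

/-!
Representing `N` as `a ^ 2 + p * b ^ 2` with `a`, `b` prime to `6` and counting modulo sign changes,
one finds, for `p + 1` dividing `6`, that `D(x) D(x ^ p)` is the sum of two series of squares; for
`p = 2` and `p = 5` these are powers of `D` and of `E = D(x ^ 5)`, and the case `p = 5` becomes the
modular equation `D E = D ^ 6 + E ^ 6`. Both halves of `T_5` (`x ^ (5 n) ↦ x ^ n` and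
`x ^ n ↦ x ^ (5 n)`) turn it into the recurrence
`T_5 (D ^ (k + 6)) = D T_5 (D ^ (k + 1)) + D ^ 6 T_5 (D ^ k)`.
Since `T_5` commutes with squaring, the recurrence also yields its own initial values:
`T_5 (D ^ k) = 0` for `k < 5`, and `T_5 (D ^ 5) ^ 2 = T_5 (D ^ 10) = D T_5 (D ^ 5)` forces
`T_5 (D ^ 5) = D`. By induction `T_5` is unitriangular from the basis `D ^ (6 m + 5)` of `W5` to the
basis `D ^ (6 m + 1)` of `W1`, hence bijective.
-/

/-! ### Counting lattice points up to signs -/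

section SignSymmetry

theorem ncard_eq_two_mul_pos_add_zero {α : Type*} {S : Set α} (hS : S.Finite) {σ : α → α}
    (hσ : Function.Involutive σ) (hσS : Set.MapsTo σ S S) (f : α → ℤ) (hf : ∀ x, f (σ x) = -f x) :
    S.ncard = 2 * {x ∈ S | 0 < f x}.ncard + {x ∈ S | f x = 0}.ncard := by
  have hneg : {x ∈ S | f x < 0}.ncard = {x ∈ S | 0 < f x}.ncard := by
    refine Set.BijOn.ncard_eq (f := σ) ⟨?_, hσ.injective.injOn, ?_⟩
    · rintro x ⟨hx, hfx⟩
      exact ⟨hσS hx, by rw [hf]; omega⟩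
    · rintro x ⟨hx, hfx⟩
      exact ⟨σ x, ⟨hσS hx, by rw [hf]; omega⟩, hσ x⟩
  have hcover : S = {x ∈ S | 0 < f x} ∪ ({x ∈ S | f x < 0} ∪ {x ∈ S | f x = 0}) := by
    ext x
    have := lt_trichotomy 0 (f x)
    simp only [Set.mem_union, Set.mem_ofPred_eq, ← and_or_left]
    exact ⟨fun hx => ⟨hx, by omega⟩, And.left⟩
  conv_lhs => rw [hcover]
  rw [Set.ncard_union_eq _ (hS.sep _) ((hS.sep _).union (hS.sep _)),
    Set.ncard_union_eq _ (hS.sep _) (hS.sep _), hneg]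
  · ring
  · exact Set.disjoint_left.2 fun x hx hx' => hx.2.ne hx'.2
  · refine Set.disjoint_left.2 fun x hx hx' => ?_
    rcases hx' with hx' | hx'
    · exact hx.2.asymm hx'.2
    · exact hx.2.ne' hx'.2

/-- Invariance of a set of lattice points under the sign changes of both coordinates. -/
def IsSignSymmetric (S : Set (ℤ × ℤ)) : Prop :=
  ∀ z ∈ S, (-z.1, z.2) ∈ S ∧ (z.1, -z.2) ∈ S

theorem ncard_natCast_mem_pos_pos (S : Set (ℤ × ℤ)) :
    {z : ℕ × ℕ | 0 < z.1 ∧ 0 < z.2 ∧ ((z.1 : ℤ), (z.2 : ℤ)) ∈ S}.ncard =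
      {z ∈ {z ∈ S | 0 < z.1} | 0 < z.2}.ncard := by
  refine Set.BijOn.ncard_eq (f := fun z => ((z.1 : ℤ), (z.2 : ℤ))) ⟨?_, ?_, ?_⟩
  · rintro z ⟨h1, h2, hz⟩
    exact ⟨⟨hz, by simpa using h1⟩, by simpa using h2⟩
  · rintro z - w - h
    simpa [Prod.ext_iff] using h
  · rintro ⟨a, b⟩ ⟨⟨hz, h1⟩, h2⟩
    lift a to ℕ using h1.le
    lift b to ℕ using h2.le
    exact ⟨(a, b), ⟨by simpa using h1, by simpa using h2, hz⟩, rfl⟩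

theorem ncard_natCast_zero_mem {S : Set (ℤ × ℤ)} (h0 : (0, 0) ∉ S) :
    {n : ℕ | ((n : ℤ), (0 : ℤ)) ∈ S}.ncard = {z ∈ {z ∈ S | 0 < z.1} | z.2 = 0}.ncard := by
  refine Set.BijOn.ncard_eq (f := fun n : ℕ => ((n : ℤ), (0 : ℤ))) ⟨fun n hn => ?_, ?_, ?_⟩
  · refine ⟨⟨hn, Int.natCast_pos.2 (Nat.pos_of_ne_zero ?_)⟩, rfl⟩
    rintro rfl
    exact h0 hn
  · rintro m - n - h
    simpa using h
  · rintro ⟨a, b⟩ ⟨⟨hz, h1⟩, rfl : b = 0⟩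
    lift a to ℕ using h1.le
    exact ⟨a, hz, rfl⟩

theorem ncard_zero_natCast_mem {S : Set (ℤ × ℤ)} (h0 : (0, 0) ∉ S) :
    {n : ℕ | ((0 : ℤ), (n : ℤ)) ∈ S}.ncard = {z ∈ {z ∈ S | z.1 = 0} | 0 < z.2}.ncard := by
  refine Set.BijOn.ncard_eq (f := fun n : ℕ => ((0 : ℤ), (n : ℤ))) ⟨fun n hn => ?_, ?_, ?_⟩
  · refine ⟨⟨hn, rfl⟩, Int.natCast_pos.2 (Nat.pos_of_ne_zero ?_)⟩
    rintro rfl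
    exact h0 hn
  · rintro m - n - h
    simpa using h
  · rintro ⟨a, b⟩ ⟨⟨hz, rfl : a = 0⟩, h2⟩
    lift b to ℕ using h2.le
    exact ⟨b, hz, rfl⟩

theorem IsSignSymmetric.ncard_eq {S : Set (ℤ × ℤ)} (hsymm : IsSignSymmetric S) (hS : S.Finite)
    (h0 : (0, 0) ∉ S) :
    S.ncard = 4 * {z : ℕ × ℕ | 0 < z.1 ∧ 0 < z.2 ∧ ((z.1 : ℤ), (z.2 : ℤ)) ∈ S}.ncard +
      2 * ({n : ℕ | ((n : ℤ), (0 : ℤ)) ∈ S}.ncard + {n : ℕ | ((0 : ℤ), (n : ℤ)) ∈ S}.ncard) := by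
  have hreflect (T : Set (ℤ × ℤ)) (hT : T.Finite) (hT' : ∀ z ∈ T, (z.1, -z.2) ∈ T) :
      T.ncard = 2 * {z ∈ T | 0 < z.2}.ncard + {z ∈ T | z.2 = 0}.ncard :=
    ncard_eq_two_mul_pos_add_zero hT (σ := fun z => (z.1, -z.2)) (fun z => by simp) hT'
      Prod.snd (fun _ => rfl)
  have horigin : {z ∈ {z ∈ S | z.1 = 0} | z.2 = 0} = ∅ := by
    ext ⟨a, b⟩
    simp only [Set.mem_ofPred_eq, Set.mem_empty_iff_false, iff_false]
    rintro ⟨⟨hz, rfl⟩, rfl⟩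
    exact h0 hz
  rw [ncard_eq_two_mul_pos_add_zero hS (σ := fun z => (-z.1, z.2)) (fun z => by simp)
      (fun z hz => (hsymm z hz).1) Prod.fst (fun _ => rfl),
    hreflect _ (hS.sep _) fun z hz => ⟨(hsymm z hz.1).2, hz.2⟩,
    hreflect {z ∈ S | z.1 = 0} (hS.sep _) fun z hz => ⟨(hsymm z hz.1).2, hz.2⟩,
    ncard_natCast_mem_pos_pos, ncard_natCast_zero_mem h0, ncard_zero_natCast_mem h0, horigin,
    Set.ncard_empty]
  ring

end SignSymmetry

/-! ### Representations by `a ^ 2 + p * b ^ 2` -/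

section Representations

theorem finite_representations {u v : ℤ} (hu : 0 < u) (hv : 0 < v) (N : ℤ) :
    {z : ℤ × ℤ | u * z.1 ^ 2 + v * z.2 ^ 2 = N}.Finite := by
  have hcoord {w a : ℤ} (hw : 0 < w) (ha : w * a ^ 2 ≤ N) : a ∈ Set.Icc (-N) N := by
    have h1 : a ^ 2 ≤ w * a ^ 2 := le_mul_of_one_le_left (sq_nonneg a) hw
    have h2 := Int.le_self_sq |a|
    rw [sq_abs] at h2
    exact abs_le.1 (by linarith)
  refine ((Set.finite_Icc (-N) N).prod (Set.finite_Icc (-N) N)).subset fun z hz => ?_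
  rw [Set.mem_ofPred_eq] at hz
  exact ⟨hcoord hu (by nlinarith [sq_nonneg z.2]), hcoord hv (by nlinarith [sq_nonneg z.1])⟩

theorem natAbs_coprime_six_iff (a : ℤ) : a.natAbs.Coprime 6 ↔ a % 2 = 1 ∧ a % 3 ≠ 0 := by
  rw [show 6 = 2 * 3 from rfl, Nat.coprime_mul_iff_right, Nat.coprime_two_right,
    Nat.coprime_comm, Nat.Prime.coprime_iff_not_dvd Nat.prime_three, Nat.odd_iff]
  omega

/-- The representations `N = a ^ 2 + p * b ^ 2` by odd integers with `a ≡ b mod 3`. -/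
def congruentReps (p N : ℕ) : Set (ℤ × ℤ) :=
  {z | Odd z.1 ∧ Odd z.2 ∧ 3 ∣ z.1 - z.2 ∧ z.1 ^ 2 + p * z.2 ^ 2 = N}

/-- The representations `N = a ^ 2 + p * b ^ 2` by natural numbers prime to `6`. -/
def coprimeReps (p N : ℕ) : Set (ℕ × ℕ) :=
  {z | z.1.Coprime 6 ∧ z.2.Coprime 6 ∧ z.1 ^ 2 + p * z.2 ^ 2 = N}

theorem finite_representations_one {p : ℕ} (hp : p ≠ 0) (N : ℕ) :
    {z : ℤ × ℤ | z.1 ^ 2 + p * z.2 ^ 2 = (N : ℤ)}.Finite := by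
  simpa only [one_mul] using
    finite_representations one_pos (Int.natCast_pos.2 (Nat.pos_of_ne_zero hp)) N

theorem ncard_congruentReps_sep_three_dvd_modEq {p : ℕ} (hp : p ≠ 0) (N : ℕ) :
    {z ∈ congruentReps p N | 3 ∣ z.1}.ncard ≡ 0 [MOD 4] := by
  have hsymm : IsSignSymmetric {z ∈ congruentReps p N | 3 ∣ z.1} := by
    rintro z ⟨⟨h1, h2, h3, hN⟩, h4⟩
    exact ⟨⟨⟨h1.neg, h2, by omega, by rwa [neg_sq]⟩, h4.neg_right⟩,
      ⟨h1, h2.neg, by simp only; omega, by rwa [neg_sq]⟩, h4⟩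
  rw [hsymm.ncard_eq ((finite_representations_one hp N).subset fun z hz => hz.1.2.2.2)
    fun h => Int.not_odd_zero h.1.1]
  simp [congruentReps, Nat.modEq_zero_iff_dvd]

/-- The representations `N = a ^ 2 + p * b ^ 2` by integers prime to `6`. -/
def signedCoprimeReps (p N : ℕ) : Set (ℤ × ℤ) :=
  {z | z.1.natAbs.Coprime 6 ∧ z.2.natAbs.Coprime 6 ∧ z.1 ^ 2 + p * z.2 ^ 2 = N}

theorem isSignSymmetric_signedCoprimeReps (p N : ℕ) : IsSignSymmetric (signedCoprimeReps p N) := by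
  rintro z ⟨h1, h2, hN⟩
  exact ⟨⟨by rwa [Int.natAbs_neg], h2, by rwa [neg_sq]⟩,
    ⟨h1, by rwa [Int.natAbs_neg], by rwa [neg_sq]⟩⟩

theorem finite_signedCoprimeReps {p : ℕ} (hp : p ≠ 0) (N : ℕ) : (signedCoprimeReps p N).Finite :=
  (finite_representations_one hp N).subset fun _ hz => hz.2.2

theorem ncard_signedCoprimeReps {p : ℕ} (hp : p ≠ 0) (N : ℕ) :
    (signedCoprimeReps p N).ncard = 4 * (coprimeReps p N).ncard := by
  have hquadrant : {z : ℕ × ℕ | 0 < z.1 ∧ 0 < z.2 ∧ ((z.1 : ℤ), (z.2 : ℤ)) ∈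
      signedCoprimeReps p N} = coprimeReps p N := by
    ext ⟨a, b⟩
    simp only [signedCoprimeReps, coprimeReps, Set.mem_ofPred_eq, Int.natAbs_natCast]
    norm_cast
    refine ⟨fun h => h.2.2, fun h => ⟨Nat.pos_of_ne_zero ?_, Nat.pos_of_ne_zero ?_, h⟩⟩
    · rintro rfl
      simp at h
    · rintro rfl
      simp at h
  rw [(isSignSymmetric_signedCoprimeReps p N).ncard_eq (finite_signedCoprimeReps hp N)
    (by simp [signedCoprimeReps]), hquadrant]
  simp [signedCoprimeReps]

theorem ncard_signedCoprimeReps_sep_three_dvd_sub {p : ℕ} (hp : p ≠ 0) (N : ℕ) :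
    (signedCoprimeReps p N).ncard = 2 * {z ∈ signedCoprimeReps p N | 3 ∣ z.1 - z.2}.ncard := by
  have hdvd_iff {z : ℤ × ℤ} (hz : z ∈ signedCoprimeReps p N) :
      3 ∣ z.1 - -z.2 ↔ ¬ 3 ∣ z.1 - z.2 := by
    have h1 := ((natAbs_coprime_six_iff _).1 hz.1).2
    have h2 := ((natAbs_coprime_six_iff _).1 hz.2.1).2
    rcases (by omega : z.1 % 3 = 1 ∨ z.1 % 3 = 2) with h1 | h1 <;> omega
  have hsymm := isSignSymmetric_signedCoprimeReps p N
  have hmirror : {z ∈ signedCoprimeReps p N | 3 ∣ z.1 - z.2}.ncard =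
      {z ∈ signedCoprimeReps p N | ¬ 3 ∣ z.1 - z.2}.ncard := by
    refine Set.BijOn.ncard_eq (f := fun z => (z.1, -z.2)) <|
      Set.InvOn.bijOn (f' := fun z => (z.1, -z.2)) ⟨fun z _ => by simp, fun z _ => by simp⟩ ?_ ?_
    · exact fun z hz => ⟨(hsymm z hz.1).2, fun h => (hdvd_iff hz.1).1 h hz.2⟩
    · exact fun z hz => ⟨(hsymm z hz.1).2, (hdvd_iff hz.1).2 hz.2⟩
  have hsplit : {z ∈ signedCoprimeReps p N | 3 ∣ z.1 - z.2}.ncard +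
      {z ∈ signedCoprimeReps p N | ¬ 3 ∣ z.1 - z.2}.ncard = (signedCoprimeReps p N).ncard :=
    Set.ncard_inter_add_ncard_sdiff_eq_ncard _ {z : ℤ × ℤ | 3 ∣ z.1 - z.2}
      (finite_signedCoprimeReps hp N)
  omega

theorem ncard_congruentReps_modEq {p : ℕ} (hp : p ≠ 0) (N : ℕ) :
    (congruentReps p N).ncard ≡ 2 * (coprimeReps p N).ncard [MOD 4] := by
  have hcoprime : {z ∈ congruentReps p N | ¬ 3 ∣ z.1} =
      {z ∈ signedCoprimeReps p N | 3 ∣ z.1 - z.2} := by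
    ext z
    simp only [signedCoprimeReps, congruentReps, Set.mem_ofPred_eq, natAbs_coprime_six_iff,
      Int.odd_iff]
    constructor
    · rintro ⟨⟨h1, h2, h3, hN⟩, h4⟩
      exact ⟨⟨by omega, by omega, hN⟩, h3⟩
    · rintro ⟨⟨h1, h2, hN⟩, h3⟩
      exact ⟨⟨h1.1, h2.1, h3, hN⟩, by omega⟩
  have hsplit : {z ∈ congruentReps p N | 3 ∣ z.1}.ncard +
      {z ∈ congruentReps p N | ¬ 3 ∣ z.1}.ncard = (congruentReps p N).ncard :=
    Set.ncard_inter_add_ncard_sdiff_eq_ncard _ {z : ℤ × ℤ | 3 ∣ z.1}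
      ((finite_representations_one hp N).subset fun z hz => hz.2.2.2)
  have hthree := ncard_congruentReps_sep_three_dvd_modEq hp N
  have h4 := ncard_signedCoprimeReps hp N
  have h2 := ncard_signedCoprimeReps_sep_three_dvd_sub hp N
  rw [hcoprime] at hsplit
  rw [Nat.ModEq] at hthree ⊢
  omega

/-- In the coordinates `a = c + p * k * l`, `b = c - k * l` the form `a ^ 2 + p * b ^ 2` becomes
diagonal, and the congruence `a ≡ b mod 6` says that `l` is an integer. -/
theorem ncard_congruentReps_eq {p k : ℕ} (hk : (p + 1) * k = 6) (N : ℕ) :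
    (congruentReps p N).ncard = {z : ℤ × ℤ | Odd (z.1 + k * z.2) ∧
      ((p + 1 : ℕ) : ℤ) * z.1 ^ 2 + ((6 * p * k : ℕ) : ℤ) * z.2 ^ 2 = N}.ncard := by
  have hk' : (p + 1 : ℤ) * k = 6 := by exact_mod_cast hk
  push_cast
  refine (Set.BijOn.ncard_eq (f := fun z : ℤ × ℤ => (z.1 + p * k * z.2, z.1 - k * z.2))
    ⟨?_, ?_, ?_⟩).symm
  · rintro ⟨c, l⟩ ⟨hodd : Odd (c + k * l), hN⟩
    have hdiff : (c + p * k * l) - (c - k * l) = 6 * l := by linear_combination l * hk'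
    have hodd' : Odd (c - k * l) := by
      rw [show c - k * l = c + k * l - 2 * (k * l) by ring]
      exact hodd.sub_even (even_two_mul _)
    have hodd'' : Odd (c + p * k * l) := by
      rw [sub_eq_iff_eq_add.1 hdiff]
      exact ((by decide : Even (6 : ℤ)).mul_right l).add_odd hodd'
    refine ⟨hodd'', hodd', ⟨2 * l, by linear_combination hdiff⟩, ?_⟩
    linear_combination hN + p * k * l ^ 2 * hk'
  · rintro ⟨c, l⟩ - ⟨c', l'⟩ - h
    obtain ⟨h1, h2⟩ := Prod.ext_iff.1 h
    simp only at h1 h2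
    obtain rfl : l = l' := by
      have : 6 * l = 6 * l' := by linear_combination h1 - h2 - (l - l') * hk'
      omega
    simpa using h2
  · rintro ⟨a, b⟩ ⟨ha, hb, h3, hN⟩
    obtain ⟨l, hl⟩ : 6 ∣ a - b := by
      simp only [Int.odd_iff] at ha hb h3
      omega
    have hcl : b + k * l + p * k * l = a := by linear_combination l * hk' - hl
    have hodd : Odd (b + k * l + k * l) := by
      rw [add_assoc]
      exact hb.add_even (Even.add_self _)
    refine ⟨(b + k * l, l), ⟨hodd, ?_⟩, Prod.ext ?_ ?_⟩
    · simp only at hN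
      rw [← hcl] at hN
      linear_combination hN - p * k * l ^ 2 * hk'
    · exact hcl
    · simp

theorem ncard_coprimeReps_modEq {p k : ℕ} (hp : p ≠ 0) (hk : (p + 1) * k = 6) (N : ℕ) :
    (coprimeReps p N).ncard ≡ {n : ℕ | Odd n ∧ (p + 1) * n ^ 2 = N}.ncard +
      {n : ℕ | Odd (k * n) ∧ 6 * p * k * n ^ 2 = N}.ncard [MOD 2] := by
  set S : Set (ℤ × ℤ) := {z | Odd (z.1 + k * z.2) ∧
    ((p + 1 : ℕ) : ℤ) * z.1 ^ 2 + ((6 * p * k : ℕ) : ℤ) * z.2 ^ 2 = N} with hS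
  have hk0 : k ≠ 0 := by
    rintro rfl
    simp at hk
  have hSfin : S.Finite :=
    (finite_representations (by positivity) (by positivity) N).subset fun _ hz => hz.2
  have hsymm : IsSignSymmetric S := by
    rintro ⟨c, l⟩ ⟨hodd : Odd (c + k * l), hN⟩
    have hodd₁ : Odd (-c + k * l) := by
      rw [show -c + k * l = c + k * l - 2 * c by ring]
      exact hodd.sub_even (even_two_mul _)
    have hodd₂ : Odd (c + k * -l) := by
      rw [show c + k * -l = c + k * l - 2 * (k * l) by ring]
      exact hodd.sub_even (even_two_mul _)
    exact ⟨⟨hodd₁, by rwa [neg_sq]⟩, hodd₂, by rwa [neg_sq]⟩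
  have haxis₁ : {n : ℕ | ((n : ℤ), (0 : ℤ)) ∈ S} = {n : ℕ | Odd n ∧ (p + 1) * n ^ 2 = N} := by
    ext n
    simp only [hS, Set.mem_ofPred_eq, mul_zero, add_zero, zero_pow two_ne_zero]
    norm_cast
  have haxis₂ : {n : ℕ | ((0 : ℤ), (n : ℤ)) ∈ S} =
      {n : ℕ | Odd (k * n) ∧ 6 * p * k * n ^ 2 = N} := by
    ext n
    simp only [hS, Set.mem_ofPred_eq, mul_zero, zero_add, zero_pow two_ne_zero]
    norm_cast
  have hmod := ncard_congruentReps_modEq hp N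
  rw [ncard_congruentReps_eq hk, ← hS, hsymm.ncard_eq hSfin (by simp [hS]), haxis₁, haxis₂] at hmod
  rw [Nat.ModEq] at hmod ⊢
  omega

end Representations

/-! ### Series of squares -/

section SquareSeries

open Classical in
/-- The series `∑ x ^ (n ^ 2)` over the `n` in `S`, modulo `2`; distinct `n` give distinct
exponents, so its coefficients are `0` or `1`. -/
noncomputable def squareSeries (S : Set ℕ) : (ZMod 2)⟦X⟧ :=
  PowerSeries.mk fun N => if ∃ n ∈ S, N = n ^ 2 then 1 else 0

theorem seriesD_eq_squareSeries : seriesD = squareSeries {n | n.Coprime 6} := by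
  classical
  ext N
  rw [seriesD, squareSeries, coeff_mk, coeff_mk]
  refine if_congr (exists_congr fun n => ?_) rfl rfl
  rw [← and_assoc]
  refine and_congr_left' ?_
  refine ⟨And.right, fun h => ⟨Nat.pos_of_ne_zero ?_, h⟩⟩
  rintro rfl
  simp at h

open Classical in
theorem coeff_squareSeries (S : Set ℕ) (N : ℕ) :
    coeff N (squareSeries S) = if ∃ n ∈ S, N = n ^ 2 then 1 else 0 :=
  coeff_mk _ _

open Classical in
theorem coeff_expand_squareSeries (S : Set ℕ) {p : ℕ} (hp : p ≠ 0) (N : ℕ) :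
    coeff N (expand p hp (squareSeries S)) = if ∃ n ∈ S, N = p * n ^ 2 then 1 else 0 := by
  rw [coeff_expand, coeff_squareSeries, ← ite_and]
  refine if_congr ⟨?_, ?_⟩ rfl rfl
  · rintro ⟨hpN, n, hn, hN⟩
    exact ⟨n, hn, by rw [← hN, Nat.mul_div_cancel' hpN]⟩
  · rintro ⟨n, hn, rfl⟩
    exact ⟨dvd_mul_right _ _, n, hn, Nat.mul_div_cancel_left _ (Nat.pos_of_ne_zero hp)⟩

theorem coeff_expand_squareSeries_eq_ncard (S : Set ℕ) {p : ℕ} (hp : p ≠ 0) (N : ℕ) :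
    coeff N (expand p hp (squareSeries S)) = ({n | n ∈ S ∧ p * n ^ 2 = N}.ncard : ZMod 2) := by
  classical
  rw [coeff_expand_squareSeries]
  split_ifs with h
  · obtain ⟨n, hn, rfl⟩ := h
    have : {m | m ∈ S ∧ p * m ^ 2 = p * n ^ 2} = {n} := by
      ext m
      simp only [Set.mem_ofPred_eq, Set.mem_singleton_iff, mul_right_inj' hp,
        (Nat.pow_left_injective two_ne_zero).eq_iff]
      exact ⟨And.right, fun hm => ⟨hm ▸ hn, hm⟩⟩
    rw [this, Set.ncard_singleton, Nat.cast_one]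
  · have : {n | n ∈ S ∧ p * n ^ 2 = N} = ∅ :=
      Set.eq_empty_of_forall_notMem fun n hn => h ⟨n, hn.1, hn.2.symm⟩
    rw [this, Set.ncard_empty, Nat.cast_zero]

theorem coeff_squareSeries_mul_expand (S T : Set ℕ) {p : ℕ} (hp : p ≠ 0) (N : ℕ) :
    coeff N (squareSeries S * expand p hp (squareSeries T)) =
      ({z : ℕ × ℕ | z.1 ∈ S ∧ z.2 ∈ T ∧ z.1 ^ 2 + p * z.2 ^ 2 = N}.ncard : ZMod 2) := by
  classical
  simp only [coeff_mul, coeff_squareSeries, coeff_expand_squareSeries, mul_ite, mul_one, mul_zero,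
    ← ite_and]
  rw [Finset.sum_boole, ← Set.ncard_coe_finset]
  congr 1
  refine (Set.BijOn.ncard_eq (f := fun z : ℕ × ℕ => (z.1 ^ 2, p * z.2 ^ 2)) ⟨?_, ?_, ?_⟩).symm
  · rintro ⟨a, b⟩ ⟨ha, hb, hN⟩
    exact Finset.mem_filter.2 ⟨Finset.HasAntidiagonal.mem_antidiagonal.2 hN,
      ⟨b, hb, rfl⟩, a, ha, rfl⟩
  · rintro ⟨a, b⟩ - ⟨c, d⟩ - h
    simpa [hp] using h
  · rintro ⟨i, j⟩ h
    simp only [Finset.coe_filter, Finset.HasAntidiagonal.mem_antidiagonal,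
      Set.mem_ofPred_eq] at h
    obtain ⟨hN, ⟨b, hb, rfl⟩, a, ha, rfl⟩ := h
    exact ⟨(a, b), ⟨ha, hb, hN⟩, rfl⟩

theorem seriesD_mul_expand {p k : ℕ} (hp : p ≠ 0) (hk : (p + 1) * k = 6) (hpk : 6 * p * k ≠ 0) :
    seriesD * expand p hp seriesD = expand (p + 1) p.succ_ne_zero (squareSeries {n | Odd n}) +
      expand (6 * p * k) hpk (squareSeries {n | Odd (k * n)}) := by
  ext N
  rw [seriesD_eq_squareSeries, coeff_squareSeries_mul_expand, map_add,
    coeff_expand_squareSeries_eq_ncard, coeff_expand_squareSeries_eq_ncard, ← Nat.cast_add]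
  exact (ZMod.natCast_eq_natCast_iff _ _ _).2 (ncard_coprimeReps_modEq hp hk N)

end SquareSeries

/-! ### The modular equation -/

section ModularEquation

theorem expand_char_eq_pow (p : ℕ) [hp : Fact p.Prime] (f : (ZMod p)⟦X⟧) :
    expand p hp.out.ne_zero f = f ^ p := by
  have h : (expand p hp.out.ne_zero f).map (frobenius (ZMod p) p) = f ^ p :=
    MvPowerSeries.map_frobenius_expand p hp.out.ne_zero
  rw [← h, ZMod.frobenius_zmod]
  simp

theorem seriesD_pow_three : seriesD ^ 3 = expand 3 three_ne_zero (squareSeries {n | Odd n}) := by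
  have hempty : squareSeries {n | Odd (2 * n)} = 0 := by
    ext N
    simp [coeff_squareSeries]
  have h := seriesD_mul_expand (p := 2) (k := 2) two_ne_zero rfl (by norm_num)
  rwa [hempty, map_zero, add_zero, expand_char_eq_pow, ← pow_succ'] at h

theorem seriesD_pow_six : seriesD ^ 6 = expand 6 (by norm_num) (squareSeries {n | Odd n}) := by
  rw [pow_mul seriesD 3 2, seriesD_pow_three, ← expand_char_eq_pow, ← expand_mul]

theorem seriesD_modular_equation :
    seriesD * expand 5 (by norm_num) seriesD =
      seriesD ^ 6 + expand 5 (by norm_num) seriesD ^ 6 := by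
  have h := seriesD_mul_expand (p := 5) (k := 1) (by norm_num) rfl (by norm_num)
  simp only [one_mul] at h
  rw [h, ← map_pow, seriesD_pow_six, ← expand_mul]

end ModularEquation

/-! ### The operator `T_5` on powers of `D` -/

section Hecke

/-- The operator `∑ c_n x ^ n ↦ ∑ c_{pn} x ^ n`, the first half of the Hecke operator. -/
noncomputable def contractSeries {R : Type*} [CommSemiring R] (p : ℕ) : R⟦X⟧ →ₗ[R] R⟦X⟧ where
  toFun f := PowerSeries.mk fun n => coeff (p * n) f
  map_add' f g := by
    ext n
    simp
  map_smul' a f := by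
    ext n
    simp

theorem coeff_contractSeries {R : Type*} [CommSemiring R] (p n : ℕ) (f : R⟦X⟧) :
    coeff n (contractSeries p f) = coeff (p * n) f := by
  exact coeff_mk n fun n => coeff (p * n) f

theorem contractSeries_expand_mul {R : Type*} [CommRing R] {p : ℕ} (hp : p ≠ 0) (f g : R⟦X⟧) :
    contractSeries p (expand p hp f * g) = f * contractSeries p g := by
  ext n
  rw [coeff_contractSeries, coeff_mul, coeff_mul]
  refine (Finset.sum_of_injOn (fun z => (p * z.1, p * z.2)) ?_ ?_ ?_ ?_).symm
  · rintro z - w - h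
    simpa [hp, Prod.ext_iff] using h
  · intro z hz
    simp only [Finset.mem_coe, Finset.HasAntidiagonal.mem_antidiagonal] at hz ⊢
    rw [← hz, mul_add]
  · rintro ⟨i, j⟩ hij hnot
    rw [Finset.HasAntidiagonal.mem_antidiagonal] at hij
    suffices ¬ p ∣ i by simp only [coeff_expand_of_not_dvd p hp f this, zero_mul]
    rintro ⟨a, rfl⟩
    obtain ⟨b, rfl⟩ : p ∣ j := (Nat.dvd_add_right (dvd_mul_right p a)).1 (hij ▸ dvd_mul_right p n)
    rw [← mul_add] at hij
    exact hnot ⟨(a, b), by simpa [hp] using hij, rfl⟩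
  · intro z _
    rw [coeff_expand_mul, coeff_contractSeries]

theorem contractSeries_expand {R : Type*} [CommRing R] {p q : ℕ} (hq : q ≠ 0)
    (hpq : q.Coprime p) (f : R⟦X⟧) :
    contractSeries p (expand q hq f) = expand q hq (contractSeries p f) := by
  ext n
  simp only [coeff_contractSeries, coeff_expand, hpq.dvd_mul_left]
  split_ifs with h
  · rw [Nat.mul_div_assoc _ h]
  · rfl

theorem heckeT_eq {p : ℕ} (hp : p ≠ 0) (f : (ZMod 2)⟦X⟧) :
    heckeT p f = contractSeries p f + expand p hp f := by
  ext n
  simp only [heckeT, LinearMap.coe_mk, AddHom.coe_mk, map_add, coeff_contractSeries, coeff_expand,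
    coeff_mk]

theorem heckeT_sq {p : ℕ} (hp : Odd p) (f : (ZMod 2)⟦X⟧) : heckeT p (f ^ 2) = heckeT p f ^ 2 := by
  simp only [← expand_char_eq_pow 2, heckeT_eq hp.pos.ne', map_add,
    contractSeries_expand two_ne_zero (Nat.coprime_two_left.2 hp), ← expand_mul, mul_comm]

theorem heckeT_eq_zero {p : ℕ} (hp : p ≠ 0) {f : (ZMod 2)⟦X⟧}
    (hf : contractSeries p f = expand p hp f) : heckeT p f = 0 := by
  rw [heckeT_eq hp, hf, ZModModule.add_self]

theorem heckeT_one {p : ℕ} (hp : p ≠ 0) : heckeT p 1 = 0 := by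
  refine heckeT_eq_zero hp ?_
  ext n
  simp [coeff_contractSeries, coeff_one, hp]

theorem contractSeries_squareSeries {p : ℕ} (hp : p.Prime) {S : Set ℕ}
    (hS : ∀ n, p * n ∈ S ↔ n ∈ S) :
    contractSeries p (squareSeries S) = expand p hp.ne_zero (squareSeries S) := by
  classical
  ext N
  rw [coeff_contractSeries, coeff_squareSeries, coeff_expand_squareSeries]
  refine if_congr ⟨?_, ?_⟩ rfl rfl
  · rintro ⟨m, hm, hN⟩
    obtain ⟨n, rfl⟩ : p ∣ m := hp.dvd_of_dvd_pow (hN ▸ dvd_mul_right p N)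
    refine ⟨n, (hS n).1 hm, Nat.eq_of_mul_eq_mul_left hp.pos ?_⟩
    rw [hN]
    ring
  · rintro ⟨n, hn, rfl⟩
    exact ⟨p * n, (hS n).2 hn, by ring⟩

theorem heckeT_seriesD {p : ℕ} (hp : p.Prime) (hp6 : p.Coprime 6) : heckeT p seriesD = 0 := by
  refine heckeT_eq_zero hp.ne_zero ?_
  rw [seriesD_eq_squareSeries]
  exact contractSeries_squareSeries hp fun n => Nat.coprime_mul_iff_left.trans (and_iff_right hp6)

theorem heckeT_five_seriesD_pow_add_six (k : ℕ) :
    heckeT 5 (seriesD ^ (k + 6)) =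
      seriesD * heckeT 5 (seriesD ^ (k + 1)) + seriesD ^ 6 * heckeT 5 (seriesD ^ k) := by
  have h5 : (5 : ℕ) ≠ 0 := by norm_num
  set E := expand 5 h5 seriesD with hE
  have hmod : seriesD * E = seriesD ^ 6 + E ^ 6 := seriesD_modular_equation
  have hcontract : contractSeries 5 (seriesD ^ (k + 6)) =
      seriesD * contractSeries 5 (seriesD ^ (k + 1)) +
        seriesD ^ 6 * contractSeries 5 (seriesD ^ k) := by
    have hpow : seriesD ^ (k + 6) =
        expand 5 h5 seriesD * seriesD ^ (k + 1) + expand 5 h5 (seriesD ^ 6) * seriesD ^ k := by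
      rw [map_pow, ← hE]
      linear_combination -seriesD ^ k * hmod - ZModModule.add_self (E ^ 6 * seriesD ^ k)
    rw [hpow, map_add, contractSeries_expand_mul, contractSeries_expand_mul]
  have hexpand : expand 5 h5 (seriesD ^ (k + 6)) = seriesD * expand 5 h5 (seriesD ^ (k + 1)) +
      seriesD ^ 6 * expand 5 h5 (seriesD ^ k) := by
    simp only [map_pow, ← hE]
    linear_combination -E ^ k * hmod - ZModModule.add_self (seriesD ^ 6 * E ^ k)
  rw [heckeT_eq h5, heckeT_eq h5, heckeT_eq h5, hcontract, hexpand]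
  ring

end Hecke

/-! ### Spans and unitriangular families -/

section Unitriangular

theorem exists_finset_sum_of_mem_span_image {ι M : Type*} [AddCommGroup M] [Module (ZMod 2) M]
    {v : ι → M} {S : Set ι} {x : M} (hx : x ∈ Submodule.span (ZMod 2) (v '' S)) :
    ∃ t : Finset ι, (∀ i ∈ t, i ∈ S) ∧ x = ∑ i ∈ t, v i := by
  obtain ⟨l, hl, rfl⟩ := (Finsupp.mem_span_image_iff_linearCombination _).1 hx
  refine ⟨l.support, fun i hi => hl hi, ?_⟩
  rw [Finsupp.linearCombination_apply, Finsupp.sum]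
  refine Finset.sum_congr rfl fun i hi => ?_
  have hone : l i = 1 := Fin.eq_one_of_ne_zero _ (Finsupp.mem_support_iff.1 hi)
  rw [hone, one_smul]

variable {ι R M N : Type*} [LinearOrder ι] [Ring R] [AddCommGroup M] [Module R M]
  [AddCommGroup N] [Module R N]

theorem linearIndependent_of_sub_mem_span_Iio {f g : ι → M} (hf : LinearIndependent R f)
    (hg : ∀ i, g i - f i ∈ Submodule.span R (f '' Set.Iio i)) : LinearIndependent R g := by
  have hlower {i j : ι} (hj : j < i) : g j ∈ Submodule.span R (f '' Set.Iio i) := by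
    rw [← sub_add_cancel (g j) (f j)]
    exact add_mem (Submodule.span_mono (Set.image_mono (Set.Iio_subset_Iio hj.le)) (hg j))
      (Submodule.subset_span ⟨j, hj, rfl⟩)
  classical
  rw [linearIndependent_iff']
  intro s c hsum
  by_contra! hne
  obtain ⟨i, hi, hmax⟩ := (s.filter (c · ≠ 0)).exists_max_image id
    (by simpa [Finset.Nonempty] using hne)
  rw [Finset.mem_filter] at hi
  have hrest : ∑ j ∈ s.erase i, c j • g j ∈ Submodule.span R (f '' Set.Iio i) := by
    refine sum_mem fun j hj => ?_
    obtain ⟨hji, hjs⟩ := Finset.mem_erase.1 hj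
    by_cases hc : c j = 0
    · rw [hc, zero_smul]
      exact zero_mem _
    · exact Submodule.smul_mem _ _
        (hlower ((hmax j (Finset.mem_filter.2 ⟨hjs, hc⟩)).lt_of_ne hji))
  have htop : c i • f i = -(c i • (g i - f i) + ∑ j ∈ s.erase i, c j • g j) := by
    rw [← Finset.add_sum_erase s _ hi.1] at hsum
    rw [smul_sub, eq_neg_iff_add_eq_zero, ← hsum]
    abel
  have hmem : c i • f i ∈ Submodule.span R (f '' Set.Iio i) := by
    rw [htop]
    exact neg_mem (add_mem (Submodule.smul_mem _ _ (hg i)) hrest)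
  have hsub : Set.Iio i ⊆ Set.univ \ {i} := fun j hj => ⟨trivial, ne_of_lt hj⟩
  exact hi.2 <| hf.eq_zero_of_smul_mem_span i (c i) <|
    Submodule.span_mono (Set.image_mono hsub) hmem

theorem span_range_eq_of_sub_mem_span_Iio [WellFoundedLT ι] {f g : ι → M}
    (hg : ∀ i, g i - f i ∈ Submodule.span R (f '' Set.Iio i)) :
    Submodule.span R (Set.range g) = Submodule.span R (Set.range f) := by
  apply le_antisymm <;> rw [Submodule.span_le, Set.range_subset_iff] <;> intro i
  · rw [← sub_add_cancel (g i) (f i)]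
    exact add_mem (Submodule.span_mono (Set.image_subset_range _ _) (hg i))
      (Submodule.subset_span ⟨i, rfl⟩)
  · induction i using WellFoundedLT.induction with
    | ind i ih =>
      rw [← sub_sub_cancel (g i) (f i)]
      refine sub_mem (Submodule.subset_span ⟨i, rfl⟩) ?_
      exact Submodule.span_le.2 (Set.image_subset_iff.2 ih) (hg i)

theorem bijOn_span_of_sub_mem_span_Iio [WellFoundedLT ι] (T : M →ₗ[R] N) {e : ι → M}
    {f : ι → N} (hf : LinearIndependent R f)
    (hT : ∀ i, T (e i) - f i ∈ Submodule.span R (f '' Set.Iio i)) :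
    Set.BijOn T (Submodule.span R (Set.range e)) (Submodule.span R (Set.range f)) := by
  have hinj : Set.InjOn T (Submodule.span R (Set.range e)) :=
    LinearMap.disjoint_ker_iff_injOn.1 (Submodule.range_ker_disjoint
      (linearIndependent_of_sub_mem_span_Iio hf hT))
  rw [← span_range_eq_of_sub_mem_span_Iio hT, ← Function.comp_def, Set.range_comp,
    ← Submodule.map_span, Submodule.map_coe]
  exact hinj.bijOn_image

end Unitriangular

/-! ### Powers of a power series without constant term -/

section Powers

theorem transcendental_of_constantCoeff_eq_zero {R : Type*} [CommRing R] [NoZeroDivisors R]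
    {f : R⟦X⟧} (hf : f ≠ 0) (h0 : constantCoeff f = 0) : Transcendental R f := by
  rw [transcendental_iff]
  intro q hq
  by_contra hne
  obtain ⟨r, hqr, hr⟩ := q.exists_eq_pow_rootMultiplicity_mul_and_not_dvd hne 0
  rw [map_zero, sub_zero] at hqr hr
  have hroot : Polynomial.aeval f r = 0 := by
    rw [hqr, map_mul, map_pow, Polynomial.aeval_X] at hq
    exact (mul_eq_zero.1 hq).resolve_left (pow_ne_zero _ hf)
  refine hr (Polynomial.X_dvd_iff.2 ?_)
  have := congrArg (constantCoeff (R := R)) hroot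
  rw [Polynomial.aeval_def, Polynomial.hom_eval₂, h0, Polynomial.eval₂_at_zero] at this
  simpa using this

theorem linearIndependent_pow_of_transcendental {R A : Type*} [CommRing R] [Ring A] [Algebra R A]
    {a : A} (ha : Transcendental R a) : LinearIndependent R fun n : ℕ => a ^ n := by
  have h := (Polynomial.basisMonomials R).linearIndependent.map' (Polynomial.aeval a).toLinearMap
    (LinearMap.ker_eq_bot.2 (transcendental_iff_injective.1 ha))
  simpa [Function.comp_def] using h

theorem coeff_pow_self {R : Type*} [CommSemiring R] {f : R⟦X⟧} (h0 : constantCoeff f = 0) (n : ℕ) :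
    coeff n (f ^ n) = coeff 1 f ^ n := by
  obtain ⟨g, rfl⟩ := X_dvd_iff.2 h0
  have h (n : ℕ) (g : R⟦X⟧) : coeff n (X ^ n * g) = constantCoeff g := by
    simpa using coeff_X_pow_mul g n 0
  rw [mul_pow, h, map_pow]
  congr 1
  simp

end Powers

/-! ### The action of `T_5` on `W5` -/

section PowersOfD

theorem constantCoeff_seriesD : constantCoeff seriesD = 0 := by
  rw [← coeff_zero_eq_constantCoeff_apply, seriesD_eq_squareSeries, coeff_squareSeries, if_neg]
  rintro ⟨n, hn, h0⟩
  rw [eq_comm, sq_eq_zero_iff] at h0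
  subst h0
  simp at hn

theorem coeff_one_seriesD : coeff 1 seriesD = 1 := by
  rw [seriesD_eq_squareSeries, coeff_squareSeries]
  exact if_pos ⟨1, Nat.coprime_one_left 6, rfl⟩

theorem seriesD_ne_zero : seriesD ≠ 0 := by
  intro h
  simpa [h] using coeff_one_seriesD

theorem linearIndependent_seriesD_pow : LinearIndependent (ZMod 2) fun k : ℕ => seriesD ^ k :=
  linearIndependent_pow_of_transcendental
    (transcendental_of_constantCoeff_eq_zero seriesD_ne_zero constantCoeff_seriesD)

theorem heckeT_five_seriesD_pow_of_lt_five {k : ℕ} (hk : k < 5) : heckeT 5 (seriesD ^ k) = 0 := by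
  have hodd : Odd 5 := by decide
  have h0 : heckeT 5 (seriesD ^ 0) = 0 := by rw [pow_zero, heckeT_one (by norm_num)]
  have h1 : heckeT 5 (seriesD ^ 1) = 0 := by
    rw [pow_one, heckeT_seriesD Nat.prime_five (by norm_num)]
  have h2 : heckeT 5 (seriesD ^ 2) = 0 := by
    rw [heckeT_sq hodd, ← pow_one seriesD, h1, zero_pow two_ne_zero]
  have h3 : heckeT 5 (seriesD ^ 3) = 0 := by
    rw [← sq_eq_zero_iff, ← heckeT_sq hodd, ← pow_mul, heckeT_five_seriesD_pow_add_six 0, h0, h1,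
      mul_zero, mul_zero, add_zero]
  have h4 : heckeT 5 (seriesD ^ 4) = 0 := by
    rw [pow_mul seriesD 2 2, heckeT_sq hodd, h2, zero_pow two_ne_zero]
  interval_cases k <;> assumption

theorem heckeT_five_seriesD_pow_five : heckeT 5 (seriesD ^ 5) = seriesD := by
  have hsq : heckeT 5 (seriesD ^ 5) * heckeT 5 (seriesD ^ 5) =
      seriesD * heckeT 5 (seriesD ^ 5) := by
    rw [← sq, ← heckeT_sq (by decide), ← pow_mul, heckeT_five_seriesD_pow_add_six 4,
      heckeT_five_seriesD_pow_of_lt_five (by norm_num : 4 < 5), mul_zero, add_zero]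
  have hcoeff : coeff 1 (heckeT 5 (seriesD ^ 5)) = 1 := by
    rw [heckeT_eq (by norm_num), map_add, coeff_contractSeries,
      coeff_expand_of_not_dvd _ _ _ (by norm_num), mul_one, add_zero,
      coeff_pow_self constantCoeff_seriesD, coeff_one_seriesD, one_pow]
  refine mul_right_cancel₀ (fun h => ?_) hsq
  simp [h] at hcoeff

/-- The span of the powers `D ^ k` with exponent in `S`. -/
noncomputable def powerSpan (S : Set ℕ) : Submodule (ZMod 2) (ZMod 2)⟦X⟧ :=
  Submodule.span (ZMod 2) ((fun k => seriesD ^ k) '' S)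

theorem seriesD_pow_mul_mem_powerSpan {S T : Set ℕ} {i : ℕ} (h : ∀ j ∈ S, i + j ∈ T)
    {f : (ZMod 2)⟦X⟧} (hf : f ∈ powerSpan S) : seriesD ^ i * f ∈ powerSpan T := by
  have hle : powerSpan S ≤ (powerSpan T).comap (LinearMap.mulLeft (ZMod 2) (seriesD ^ i)) := by
    rw [powerSpan, Submodule.span_le, Set.image_subset_iff]
    intro j hj
    exact Submodule.subset_span ⟨i + j, h j hj, pow_add _ _ _⟩
  exact hle hf

theorem heckeT_five_seriesD_pow_mem (k : ℕ) :
    heckeT 5 (seriesD ^ k) ∈ powerSpan {j | j ≡ 5 * k [MOD 6] ∧ j + 4 ≤ k} := by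
  induction k using Nat.strong_induction_on with
  | _ k ih =>
    rcases lt_trichotomy k 5 with hk | rfl | hk
    · rw [heckeT_five_seriesD_pow_of_lt_five hk]
      exact zero_mem _
    · rw [heckeT_five_seriesD_pow_five]
      exact Submodule.subset_span ⟨1, ⟨rfl, le_rfl⟩, pow_one _⟩
    · obtain ⟨k, rfl⟩ := Nat.exists_eq_add_of_le' (Nat.succ_le_of_lt hk)
      rw [heckeT_five_seriesD_pow_add_six]
      refine add_mem ?_ (seriesD_pow_mul_mem_powerSpan ?_ (ih k (by omega)))
      · nth_rewrite 1 [← pow_one seriesD]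
        refine seriesD_pow_mul_mem_powerSpan ?_ (ih (k + 1) (by omega))
        rintro j ⟨hj, hjk⟩
        rw [Nat.ModEq] at hj
        exact ⟨by rw [Nat.ModEq]; omega, by omega⟩
      · rintro j ⟨hj, hjk⟩
        rw [Nat.ModEq] at hj
        exact ⟨by rw [Nat.ModEq]; omega, by omega⟩

theorem heckeT_five_seriesD_pow_sub_mem_powerSpan (m : ℕ) :
    heckeT 5 (seriesD ^ (6 * m + 5)) - seriesD ^ (6 * m + 1) ∈
      powerSpan ((fun r => 6 * r + 1) '' Set.Iio m) := by
  induction m with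
  | zero => simp [heckeT_five_seriesD_pow_five]
  | succ m ih =>
    have hrec : heckeT 5 (seriesD ^ (6 * (m + 1) + 5)) - seriesD ^ (6 * (m + 1) + 1) =
        seriesD ^ 1 * heckeT 5 (seriesD ^ (6 * m + 6)) +
          seriesD ^ 6 * (heckeT 5 (seriesD ^ (6 * m + 5)) - seriesD ^ (6 * m + 1)) := by
      rw [show 6 * (m + 1) + 5 = (6 * m + 5) + 6 by ring, heckeT_five_seriesD_pow_add_six]
      ring
    rw [hrec]
    refine add_mem
      (seriesD_pow_mul_mem_powerSpan ?_ (heckeT_five_seriesD_pow_mem (6 * m + 6)))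
      (seriesD_pow_mul_mem_powerSpan ?_ ih)
    · rintro j ⟨hj, hjm⟩
      rw [Nat.ModEq] at hj
      exact ⟨j / 6, by rw [Set.mem_Iio]; omega, by simp only; omega⟩
    · rintro - ⟨r, hr, rfl⟩
      rw [Set.mem_Iio] at hr
      exact ⟨r + 1, by rw [Set.mem_Iio]; omega, by ring⟩

theorem heckeT_five_seriesD_pow_sub_mem (m : ℕ) :
    heckeT 5 (seriesD ^ (6 * m + 5)) - seriesD ^ (6 * m + 1) ∈
      Submodule.span (ZMod 2) ((fun r => seriesD ^ (6 * r + 1)) '' Set.Iio m) := by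
  have h := heckeT_five_seriesD_pow_sub_mem_powerSpan m
  rwa [powerSpan, Set.image_image] at h

theorem setOf_seriesD_pow_modEq {a : ℕ} (ha : 0 < a) (ha' : a < 6) :
    {f | ∃ k : ℕ, 0 < k ∧ k ≡ a [MOD 6] ∧ f = seriesD ^ k} =
      Set.range fun m => seriesD ^ (6 * m + a) := by
  ext f
  constructor
  · rintro ⟨k, -, hk, rfl⟩
    rw [Nat.ModEq, Nat.mod_eq_of_lt ha'] at hk
    exact ⟨k / 6, congrArg (seriesD ^ ·) (by omega)⟩
  · rintro ⟨m, rfl⟩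
    exact ⟨6 * m + a, by omega, by simp [Nat.ModEq], rfl⟩

end PowersOfD

theorem theorem4p20 :
    (∀ m : ℕ, ∃ s : Finset ℕ, (∀ r ∈ s, r < m) ∧
      heckeT 5 (seriesD ^ (6 * m + 5)) =
        seriesD ^ (6 * m + 1) + ∑ r ∈ s, seriesD ^ (6 * r + 1)) ∧
    Set.BijOn (heckeT 5) (spaceW5 : Set (PowerSeries (ZMod 2)))
      (spaceW1 : Set (PowerSeries (ZMod 2))) := by
  refine ⟨fun m => ?_, ?_⟩
  · obtain ⟨s, hs, hsum⟩ :=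
      exists_finset_sum_of_mem_span_image (heckeT_five_seriesD_pow_sub_mem m)
    exact ⟨s, hs, sub_eq_iff_eq_add'.1 hsum⟩
  · have hindep : LinearIndependent (ZMod 2) fun m : ℕ => seriesD ^ (6 * m + 1) :=
      linearIndependent_seriesD_pow.comp (fun m => 6 * m + 1) fun m n h => by
        simpa using h
    rw [spaceW5, spaceW1, setOf_seriesD_pow_modEq (by norm_num) (by norm_num),
      setOf_seriesD_pow_modEq (by norm_num) (by norm_num)]
    exact bijOn_span_of_sub_mem_span_Iio (heckeT 5) hindep heckeT_five_seriesD_pow_sub_mem
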